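/- Let $\alpha(0),\alpha(1),\alpha(2),\dots$ be a sequence of positive real numbers that is log-polynomial of degree $m\ge 2$ with data $\{A(n),\kappa,\delta(n)\}$, where $\kappa\in\{1,-1\}$. This means that $A(n)$, $\delta(n)$ and $g_k(n)$ ($3\le k\le m$) are real sequences with $\delta(n)>0$ for all $n$, $\delta(n)\to 0$ and $g_k(n)=o(\delta(n)^k)$ as $n\to\infty$, such that for each $j=1,2,\dots,m+1$, as $n\to\infty$, $$\log\left(\frac{\alpha(n+j)}{\alpha(n)}\right)=A(n)\,j+\kappa\,\delta(n)^2j^2+\sum_{k=3}^{m}g_k(n)\,j^k+o\left(\delta(n)^{m+1}\right).$$ For $d\ge 1$ and $n\ge 0$ put $$J_\alpha^{d,n}(X)=\sum_{j=0}^d\binom dj\alpha(n+j)X^j,\qquad K_\alpha^{d,n}(X)=\sum_{j=0}^d\binom dj\alpha(n+j)X^{d-j}.$$ (i) If $\kappa=-1$, then $\alpha$ is asymptotically strictly log-concave, that is, $\alpha(n+1)^2>\alpha(n)\alpha(n+2)$ for all sufficiently large $n$. If $\kappa=1$, then $\alpha$ is asymptotically strictly log-convex, that is, $\alpha(n+1)^2<\alpha(n)\alpha(n+2)$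 for all sufficiently large $n$. (ii) Fix $d$ with $1\le d\le m+1$. For all sufficiently large $n$ the following holds for each of the polynomials $J_\alpha^{d,n}$ and $K_\alpha^{d,n}$. Its $d$ complex zeros are distinct. If $\kappa=-1$, they are all real. If $\kappa=1$ and $d$ is even, none of them is real. If $\kappa=1$ and $d$ is odd, exactly one of them is real. -/

import Mathlib

open Filter Topology Asymptotics Polynomial

noncomputable section

/-- `α` is log-polynomial of degree `m ≥ 2` with data `{A(n), κ, δ(n)}`. -/
structure IsLogPolynomial (α : ℕ → ℝ) (m : ℕ) (A : ℕ → ℝ) (κ : ℝ) (δ : ℕ → ℝ) : Prop where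
  two_le : 2 ≤ m
  pos : ∀ n, 0 < α n
  kappa : κ = 1 ∨ κ = -1
  delta_pos : ∀ n, 0 < δ n
  delta_tendsto : Tendsto δ atTop (𝓝 0)
  expansion : ∃ g : ℕ → ℕ → ℝ,
    (∀ k ∈ Finset.Icc 3 m, (fun n => g k n) =o[atTop] (fun n => δ n ^ k)) ∧
    ∀ j ∈ Finset.Icc 1 (m + 1),
      (fun n => Real.log (α (n + j) / α n) -
        (A n * (j : ℝ) + κ * δ n ^ 2 * (j : ℝ) ^ 2 + ∑ k ∈ Finset.Icc 3 m, g k n * (j : ℝ) ^ k))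
      =o[atTop] (fun n => δ n ^ (m + 1))

/-- The inequality of strict log-concavity holds for all large `n`. -/
def AsympStrictLogConcave (α : ℕ → ℝ) : Prop :=
  ∀ᶠ n in atTop, α n * α (n + 2) < α (n + 1) ^ 2

/-- The inequality of strict log-convexity holds for all large `n`. -/
def AsympStrictLogConvex (α : ℕ → ℝ) : Prop :=
  ∀ᶠ n in atTop, α (n + 1) ^ 2 < α n * α (n + 2)

/-- The Jensen polynomial `J_α^{d,n}`. -/
def jensenJ (α : ℕ → ℝ) (d n : ℕ) : ℝ[X] :=
  ∑ j ∈ Finset.range (d + 1), C ((d.choose j : ℝ) * α (n + j)) * X ^ j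

/-- The reciprocal Jensen polynomial `K_α^{d,n}`. -/
def jensenK (α : ℕ → ℝ) (d n : ℕ) : ℝ[X] :=
  ∑ j ∈ Finset.range (d + 1), C ((d.choose j : ℝ) * α (n + j)) * X ^ (d - j)

end

/-! Put E_n(j) = α(n+j) / α(n) · exp(-A(n) j). The expansion says that, up to o(δ^(m+1)), E_n(j) is
a polynomial in δ(n) j of bounded degree whose coefficients tend to those of a truncation of
exp(κx²). The sum of binom(d,j) j^s x^j is (x d/dx)^s (1+x)^d. At x = δw - 1, where 1 + x = δw, the
operator δ x d/dx becomes (δw - 1) d/dw, which tends to -d/dw. So J, at exp(-A)(δw - 1) and divided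
by α(n) δ^d, tends to exp(κD²) X^d at w; the error is harmless because d ≤ m + 1
(`tendsto_rescaled_jensen`).

The limit is a rescaled Hermite polynomial. Its zeros are simple, real for κ = -1 and purely
imaginary for κ = 1, with 0 among them exactly when d is odd. Simple zeros persist under small
perturbation, and conjugation symmetry keeps real ones real (`eventually_hasRootPattern`). The
substitution is real affine, so J inherits the pattern, and K has the inverse zeros. Part (i) is the
second difference of the expansion. -/

/-! ### The limit polynomials: rescaled Hermite polynomials and their zeros -/

/-- The polynomials `exp (κ D²) X ^ d`, with `D` the derivative: rescaled Hermite polynomials. -/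
noncomputable def heatPoly (κ : ℂ) : ℕ → ℂ[X]
  | 0 => 1
  | d + 1 => X * heatPoly κ d + C (2 * κ) * derivative (heatPoly κ d)

theorem derivative_heatPoly_succ (κ : ℂ) (d : ℕ) :
    derivative (heatPoly κ (d + 1)) = C (d + 1 : ℂ) * heatPoly κ d := by
  induction d with
  | zero => simp [heatPoly]
  | succ d ih =>
    rw [heatPoly, derivative_add, derivative_mul, derivative_C_mul, ih, derivative_C_mul]
    conv_rhs => rw [heatPoly]
    simp only [derivative_X, heatPoly]
    push_cast
    simp only [map_add, map_mul, map_one]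
    ring

theorem natDegree_heatPoly_and_monic (κ : ℂ) (d : ℕ) :
    (heatPoly κ d).natDegree = d ∧ (heatPoly κ d).Monic := by
  induction d with
  | zero => simp [heatPoly]
  | succ d ih =>
    obtain ⟨h1, h2⟩ := ih
    have hX : (X * heatPoly κ d).Monic := monic_X.mul h2
    have hXd : (X * heatPoly κ d).natDegree = d + 1 := by
      rw [natDegree_X_mul h2.ne_zero, h1]
    have hlt : (C (2 * κ) * derivative (heatPoly κ d)).degree < (X * heatPoly κ d).degree := by
      rw [degree_eq_natDegree hX.ne_zero, hXd]
      refine lt_of_le_of_lt degree_le_natDegree ?_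
      have h3 := natDegree_C_mul_le (2 * κ) (derivative (heatPoly κ d))
      have h4 := natDegree_derivative_le (heatPoly κ d)
      exact_mod_cast (by omega :
        (C (2 * κ) * derivative (heatPoly κ d)).natDegree < d + 1)
    refine ⟨?_, ?_⟩
    · rw [heatPoly, natDegree_add_eq_left_of_degree_lt hlt, hXd]
    · rw [heatPoly]; exact hX.add_of_left hlt

theorem natDegree_heatPoly (κ : ℂ) (d : ℕ) : (heatPoly κ d).natDegree = d :=
  (natDegree_heatPoly_and_monic κ d).1

theorem monic_heatPoly (κ : ℂ) (d : ℕ) : (heatPoly κ d).Monic :=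
  (natDegree_heatPoly_and_monic κ d).2

/-- Descent in d: the derivative is a multiple of the previous polynomial, so a double zero is a
zero of that polynomial, and the recursion then makes it a double zero there too. The descent ends
at the constant 1. -/
theorem heatPoly_no_common_root {κ : ℂ} (hκ : κ ≠ 0) (d : ℕ) (z : ℂ)
    (h0 : (heatPoly κ d).eval z = 0) : (derivative (heatPoly κ d)).eval z ≠ 0 := by
  induction d with
  | zero => simp [heatPoly] at h0
  | succ d ih =>
    intro h1
    rw [derivative_heatPoly_succ, eval_mul, eval_C] at h1
    have hz : (heatPoly κ d).eval z = 0 :=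
      (mul_eq_zero.mp h1).resolve_left (Nat.cast_add_one_ne_zero d)
    refine ih hz ?_
    simpa [heatPoly, hz, hκ] using h0

theorem nodup_roots_heatPoly {κ : ℂ} (hκ : κ ≠ 0) (d : ℕ) : (heatPoly κ d).roots.Nodup := by
  classical
  rw [Multiset.nodup_iff_count_le_one]
  intro z
  rw [count_roots]
  by_contra! h
  rw [one_lt_rootMultiplicity_iff_isRoot (monic_heatPoly κ d).ne_zero] at h
  exact heatPoly_no_common_root hκ d z h.1 h.2

theorem card_roots_heatPoly (κ : ℂ) (d : ℕ) : (heatPoly κ d).roots.card = d := by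
  rw [IsAlgClosed.card_roots_eq_natDegree, natDegree_heatPoly]

/-- The roots of `heatPoly κ d` lie on the line `Re (u z) = 0`, where `κ u² = 1`. -/
theorem re_mul_eq_zero_of_heatPoly_root {κ u : ℂ} (hu : κ * u ^ 2 = 1) (d : ℕ) :
    ∀ z : ℂ, (heatPoly κ d).eval z = 0 → (u * z).re = 0 := by
  induction d with
  | zero => simp [heatPoly]
  | succ d ih =>
    intro z hz
    have hu0 : u ≠ 0 := by rintro rfl; simp at hu
    by_cases h0 : (heatPoly κ d).eval z = 0
    · exact ih z h0
    have hsum := (IsAlgClosed.splits (heatPoly κ d)).eval_derivative_eq_eval_mul_sum h0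
    set S := ((heatPoly κ d).roots.map fun y ↦ 1 / (z - y)) with hS
    have hzS : z + 2 * κ * S.sum = 0 := by
      have : (heatPoly κ d).eval z * (z + 2 * κ * S.sum) = 0 := by
        simp only [heatPoly, eval_add, eval_mul, eval_X, eval_C, hsum] at hz
        linear_combination hz
      exact (mul_eq_zero.mp this).resolve_left h0
    -- The logarithmic derivative gives z = -2κ Σ 1/(z - y). Multiply by u and use κu = u⁻¹.
    have huz : u * z = -2 * ((heatPoly κ d).roots.map fun y ↦ (u * z - u * y)⁻¹).sum := by
      have h1 : ((heatPoly κ d).roots.map fun y ↦ (u * z - u * y)⁻¹).sum = u⁻¹ * S.sum := by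
        rw [hS, ← Multiset.sum_map_mul_left]
        congr 1
        refine Multiset.map_congr rfl fun y _ => ?_
        rw [← mul_sub, mul_inv, one_div]
      rw [h1]
      have h2 : u * (z + 2 * κ * S.sum) = 0 := by rw [hzS, mul_zero]
      field_simp
      linear_combination u * h2 - 2 * S.sum * hu
    -- By induction every u y is purely imaginary, so each term has real part Re(u z) / |u z - u
    -- y|², a nonnegative multiple of Re(u z).
    have hre : (((heatPoly κ d).roots.map fun y ↦ (u * z - u * y)⁻¹).sum).re =
        (u * z).re * ((heatPoly κ d).roots.map
          fun y ↦ (Complex.normSq (u * z - u * y))⁻¹).sum := by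
      rw [← Multiset.sum_map_mul_left, ← Complex.coe_reAddGroupHom, map_multiset_sum,
        Multiset.map_map]
      congr 1
      refine Multiset.map_congr rfl fun y hy => ?_
      have hy0 := ih y ((mem_roots'.mp hy).2)
      simp only [Function.comp, Complex.coe_reAddGroupHom, Complex.inv_re, Complex.sub_re, hy0,
        sub_zero, div_eq_mul_inv]
    have hnn : 0 ≤ ((heatPoly κ d).roots.map
        fun y ↦ (Complex.normSq (u * z - u * y))⁻¹).sum := by
      refine Multiset.sum_nonneg fun x hx => ?_
      obtain ⟨y, -, rfl⟩ := Multiset.mem_map.mp hx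
      exact inv_nonneg.mpr (Complex.normSq_nonneg _)
    set T := ((heatPoly κ d).roots.map fun y ↦ (Complex.normSq (u * z - u * y))⁻¹).sum
    have hfin : (u * z).re * (1 + 2 * T) = 0 := by
      have := congrArg Complex.re huz
      rw [show (-2 : ℂ) = ((-2 : ℝ) : ℂ) by norm_num, Complex.re_ofReal_mul, hre] at this
      linear_combination this
    exact (mul_eq_zero.mp hfin).resolve_right (by positivity)

theorem eval_zero_heatPoly_eq_zero_iff {κ : ℂ} (hκ : κ ≠ 0) (d : ℕ) :
    (heatPoly κ d).eval 0 = 0 ↔ Odd d := by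
  induction d using Nat.twoStepInduction with
  | zero => simp [heatPoly]
  | one => simp [heatPoly]
  | more d ih _ =>
    rw [heatPoly, derivative_heatPoly_succ]
    simp only [eval_add, eval_mul, eval_X, eval_C, zero_mul, zero_add, mul_eq_zero, hκ, ih,
      Nat.cast_add_one_ne_zero, false_or, OfNat.ofNat_ne_zero]
    rw [Nat.odd_add]; simp

/-- By Leibniz, D^(2r)(X · X^d) = X D^(2r) X^d + 2r D^(2r-1) X^d, and the second terms sum to 2κ D
exp(κD²) X^d. The bound on d makes all omitted terms vanish. -/
theorem sum_iterate_derivative_X_pow (κ : ℂ) {d R : ℕ} (h : d < 2 * R) :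
    ∑ r ∈ Finset.range R, C (κ ^ r / (r.factorial : ℂ)) * derivative^[2 * r] (X ^ d : ℂ[X]) =
      heatPoly κ d := by
  induction d generalizing R with
  | zero =>
    rw [Finset.sum_eq_single 0]
    · simp [heatPoly]
    · intro r _ hr
      rw [pow_zero, iterate_derivative_one (by omega), mul_zero]
    · intro h0; simp at h0; omega
  | succ d ih =>
    obtain ⟨R, rfl⟩ : ∃ R', R = R' + 1 := ⟨R - 1, by omega⟩
    rw [heatPoly]
    have hd : C (2 * κ) * derivative (heatPoly κ d) = ∑ r ∈ Finset.range R,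
        C (2 * κ * (κ ^ r / (r.factorial : ℂ))) * derivative^[2 * r + 1] (X ^ d : ℂ[X]) := by
      rw [← ih (R := R + 1) (by omega), Finset.sum_range_succ, derivative_add, derivative_sum,
        derivative_C_mul, ← Function.iterate_succ_apply' (⇑derivative),
        iterate_derivative_eq_zero (x := (2 * R).succ) (by rw [natDegree_X_pow]; omega)]
      rw [mul_zero, add_zero, Finset.mul_sum]
      refine Finset.sum_congr rfl fun r _ => ?_
      rw [derivative_C_mul, ← mul_assoc, ← C_mul, ← Function.iterate_succ_apply' (⇑derivative)]
    rw [hd, ← ih (R := R + 1) (by omega), Finset.sum_range_succ' _ R, Finset.sum_range_succ' _ R,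
      mul_add, Finset.mul_sum, add_right_comm, ← Finset.sum_add_distrib]
    congr 1
    · refine Finset.sum_congr rfl fun r _ => ?_
      rw [pow_succ X d, iterate_derivative_mul_X, mul_add, show 2 * (r + 1) - 1 = 2 * r + 1 by omega]
      congr 1
      · ring
      · rw [nsmul_eq_mul, ← mul_assoc, ← C_eq_natCast, ← C_mul]
        congr 2
        have h1 : ((r.factorial : ℕ) : ℂ) ≠ 0 := by exact_mod_cast r.factorial_ne_zero
        have h2 : ((r : ℂ) + 1) ≠ 0 := Nat.cast_add_one_ne_zero r
        rw [Nat.factorial_succ]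
        push_cast
        field_simp
        ring
    · simp [pow_succ']

/-! ### Binomial power sums near x = -1 -/

/-- Absorb one factor j into the binomial coefficient, shift the index and expand (i + 1)^s. This
lowers both d and the exponent, which drives the induction for the limit below. -/
theorem sum_choose_mul_pow_succ (d s : ℕ) (x : ℂ) :
    ∑ j ∈ Finset.range (d + 1 + 1), ((d + 1).choose j : ℂ) * (j : ℂ) ^ (s + 1) * x ^ j =
      (d + 1) * x * ∑ a ∈ Finset.range (s + 1), (s.choose a : ℂ) *
        ∑ i ∈ Finset.range (d + 1), (d.choose i : ℂ) * (i : ℂ) ^ a * x ^ i := by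
  rw [Finset.sum_range_succ']
  simp only [Nat.cast_zero, ne_eq, Nat.add_eq_zero_iff, one_ne_zero, and_false, not_false_eq_true,
    zero_pow, mul_zero, zero_mul, add_zero]
  simp_rw [Finset.mul_sum]
  rw [Finset.sum_comm]
  refine Finset.sum_congr rfl fun i _ => ?_
  have h1 : ((d + 1).choose (i + 1) : ℂ) * (i + 1) = (d + 1) * d.choose i := by
    exact_mod_cast (Nat.add_one_mul_choose_eq d i).symm
  have h2 : ((i : ℂ) + 1) ^ s = ∑ a ∈ Finset.range (s + 1), (s.choose a : ℂ) * (i : ℂ) ^ a := by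
    rw [add_pow]
    refine Finset.sum_congr rfl fun a _ => ?_
    rw [one_pow, mul_one, mul_comm]
  calc ((d + 1).choose (i + 1) : ℂ) * ((i + 1 : ℕ) : ℂ) ^ (s + 1) * x ^ (i + 1)
      = (((d + 1).choose (i + 1) : ℂ) * (i + 1)) * ((i : ℂ) + 1) ^ s * x ^ (i + 1) := by
        push_cast; ring
    _ = _ := by
        rw [h1, h2, Finset.mul_sum, Finset.sum_mul]
        refine Finset.sum_congr rfl fun a _ => ?_
        ring

theorem tendsto_rescaled_power_sum {ε : ℕ → ℂ} (hε : Tendsto ε atTop (𝓝 0)) (hε0 : ∀ n, ε n ≠ 0)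
    (w : ℂ) (s d : ℕ) :
    Tendsto (fun n => ε n ^ s * (∑ j ∈ Finset.range (d + 1),
        (d.choose j : ℂ) * (j : ℂ) ^ s * (ε n * w - 1) ^ j) / ε n ^ d) atTop
      (𝓝 ((-1) ^ s * (derivative^[s] (X ^ d : ℂ[X])).eval w)) := by
  induction s using Nat.strong_induction_on generalizing d with
  | _ s ih =>
  cases s with
  | zero =>
    refine tendsto_const_nhds.congr fun n => ?_
    have : ∑ j ∈ Finset.range (d + 1), (d.choose j : ℂ) * (j : ℂ) ^ 0 * (ε n * w - 1) ^ j =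
        (ε n * w) ^ d := by
      conv_rhs => rw [show ε n * w = (ε n * w - 1) + 1 by ring, add_pow]
      refine Finset.sum_congr rfl fun j _ => ?_
      ring
    rw [this]
    have := hε0 n
    simp only [pow_zero, one_mul, Function.iterate_zero, id, eval_pow, eval_X, mul_pow]
    field_simp
  | succ s =>
    cases d with
    | zero => simp
    | succ d =>
      have h1 : Tendsto (fun n => ((d : ℂ) + 1) * (ε n * w - 1) * ∑ a ∈ Finset.range (s + 1),
          (s.choose a : ℂ) * ε n ^ (s - a) * (ε n ^ a * (∑ j ∈ Finset.range (d + 1),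
            (d.choose j : ℂ) * (j : ℂ) ^ a * (ε n * w - 1) ^ j) / ε n ^ d)) atTop
          (𝓝 (((d : ℂ) + 1) * (0 * w - 1) * ∑ a ∈ Finset.range (s + 1),
          (s.choose a : ℂ) * 0 ^ (s - a) *
            ((-1) ^ a * (derivative^[a] (X ^ d : ℂ[X])).eval w))) := by
        refine (tendsto_const_nhds.mul ((hε.mul_const w).sub_const 1)).mul
          (tendsto_finsetSum _ fun a ha => ?_)
        exact (tendsto_const_nhds.mul (hε.pow _)).mul (ih a (Finset.mem_range.mp ha) d)
      have h2 : ((d : ℂ) + 1) * (0 * w - 1) * ∑ a ∈ Finset.range (s + 1),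
          (s.choose a : ℂ) * 0 ^ (s - a) * ((-1) ^ a * (derivative^[a] (X ^ d : ℂ[X])).eval w) =
          (-1) ^ (s + 1) * (derivative^[s + 1] (X ^ (d + 1) : ℂ[X])).eval w := by
        -- Terms with a < s keep a factor ε^(s-a), which tends to 0.
        rw [Finset.sum_eq_single s]
        · rw [Function.iterate_succ_apply, derivative_X_pow, Nat.add_sub_cancel,
            iterate_derivative_C_mul]
          simp
          ring
        · intro a ha has
          have := Finset.mem_range.mp ha
          rw [zero_pow (by omega)]; ring
        · intro h; simp at h
      rw [← h2]
      refine h1.congr fun n => ?_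
      rw [sum_choose_mul_pow_succ, Finset.mul_sum, Finset.mul_sum, Finset.mul_sum, Finset.sum_div]
      refine Finset.sum_congr rfl fun a ha => ?_
      have ha' : s = (s - a) + a := by have := Finset.mem_range.mp ha; omega
      have hs : ε n ^ (s + 1) = ε n ^ (s - a) * ε n ^ a * ε n := by
        rw [← pow_add, ← ha', pow_succ]
      have := hε0 n
      rw [hs]
      field_simp
      ring

theorem tendsto_rescaled_sum {ε : ℕ → ℂ} (hε : Tendsto ε atTop (𝓝 0)) (hε0 : ∀ n, ε n ≠ 0)
    (w : ℂ) (d N : ℕ) {a : ℕ → ℕ → ℂ} {c : ℕ → ℂ}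
    (ha : ∀ s, Tendsto (fun n => a n s) atTop (𝓝 (c s))) :
    Tendsto (fun n => (∑ j ∈ Finset.range (d + 1), (d.choose j : ℂ) *
        (∑ s ∈ Finset.range N, a n s * (ε n * j) ^ s) * (ε n * w - 1) ^ j) / ε n ^ d) atTop
      (𝓝 (∑ s ∈ Finset.range N, c s * ((-1) ^ s * (derivative^[s] (X ^ d : ℂ[X])).eval w))) := by
  refine (tendsto_finsetSum _ fun s _ =>
    (ha s).mul (tendsto_rescaled_power_sum hε hε0 w s d)).congr fun n => ?_
  simp_rw [Finset.mul_sum, Finset.sum_mul, Finset.sum_div, Finset.mul_sum]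
  rw [Finset.sum_comm]
  refine Finset.sum_congr rfl fun j _ => Finset.sum_congr rfl fun s _ => ?_
  ring

/-! ### Coefficientwise convergence -/

/-- Coefficientwise convergence of a sequence of polynomials. -/
def CoeffTendsto (p : ℕ → ℝ[X]) (q : ℝ[X]) : Prop :=
  ∀ s, Tendsto (fun n => (p n).coeff s) atTop (𝓝 (q.coeff s))

namespace CoeffTendsto

theorem const (q : ℝ[X]) : CoeffTendsto (fun _ => q) q := fun _ => tendsto_const_nhds

theorem C {a : ℕ → ℝ} {b : ℝ} (h : Tendsto a atTop (𝓝 b)) :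
    CoeffTendsto (fun n => Polynomial.C (a n)) (Polynomial.C b) := by
  intro s
  simp only [coeff_C]
  split_ifs
  · exact h
  · exact tendsto_const_nhds

theorem add {p p' : ℕ → ℝ[X]} {q q' : ℝ[X]} (h : CoeffTendsto p q) (h' : CoeffTendsto p' q') :
    CoeffTendsto (fun n => p n + p' n) (q + q') := by
  intro s
  simp only [coeff_add]
  exact (h s).add (h' s)

theorem sum {ι : Type*} (t : Finset ι) {p : ι → ℕ → ℝ[X]} {q : ι → ℝ[X]}
    (h : ∀ i ∈ t, CoeffTendsto (p i) (q i)) :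
    CoeffTendsto (fun n => ∑ i ∈ t, p i n) (∑ i ∈ t, q i) := by
  intro s
  simp only [finsetSum_coeff]
  exact tendsto_finsetSum _ fun i hi => h i hi s

theorem mul {p p' : ℕ → ℝ[X]} {q q' : ℝ[X]} (h : CoeffTendsto p q) (h' : CoeffTendsto p' q') :
    CoeffTendsto (fun n => p n * p' n) (q * q') := by
  intro s
  simp only [coeff_mul]
  exact tendsto_finsetSum _ fun i _ => (h _).mul (h' _)

theorem pow {p : ℕ → ℝ[X]} {q : ℝ[X]} (h : CoeffTendsto p q) (r : ℕ) :
    CoeffTendsto (fun n => p n ^ r) (q ^ r) := by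
  induction r with
  | zero => simpa using const 1
  | succ r ih => simpa only [pow_succ] using ih.mul h

end CoeffTendsto

/-! ### Asymptotics of log-polynomial sequences -/

namespace IsLogPolynomial

variable {α : ℕ → ℝ} {m : ℕ} {A : ℕ → ℝ} {κ : ℝ} {δ : ℕ → ℝ}

theorem delta_pow_isLittleO (hα : IsLogPolynomial α m A κ δ) {a b : ℕ} (h : a < b) :
    (fun n => δ n ^ b) =o[atTop] (fun n => δ n ^ a) :=
  (isLittleO_pow_pow h).comp_tendsto hα.delta_tendsto

/-- Compose a Taylor polynomial of exp with the polynomial part `ℓ n` of the exponent, written in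
the variable δj. Since g_k = o(δ^k), `ℓ n` tends to κX². The degree bound is uniform in n, so limits
may be taken coefficient by coefficient. -/
theorem exists_poly_approx (hα : IsLogPolynomial α m A κ δ) :
    ∃ p : ℕ → ℝ[X], (∀ n, (p n).natDegree < (m + 1) * m + 1) ∧
      CoeffTendsto p
        (∑ r ∈ Finset.range (m + 2), C (κ ^ r / (r.factorial : ℝ)) * X ^ (2 * r)) ∧
      ∀ j ≤ m + 1,
        Tendsto (fun n => α (n + j) / α n * Real.exp (-(A n * j))) atTop (𝓝 1) ∧
        (fun n => α (n + j) / α n * Real.exp (-(A n * j)) - (p n).eval (δ n * j))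
          =o[atTop] (fun n => δ n ^ (m + 1)) := by
  obtain ⟨g, hg, hexp⟩ := hα.expansion
  have hm := hα.two_le
  have hδ0 : ∀ n, δ n ≠ 0 := fun n => (hα.delta_pos n).ne'
  let ℓ : ℕ → ℝ[X] := fun n =>
    C κ * X ^ 2 + ∑ k ∈ Finset.Icc 3 m, C (g k n / δ n ^ k) * X ^ k
  have hℓdeg : ∀ n, (ℓ n).natDegree ≤ m := fun n => by
    refine natDegree_add_le_of_degree_le ((natDegree_C_mul_X_pow_le _ _).trans hm)
      (natDegree_sum_le_of_forall_le _ _ fun k hk => ?_)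
    exact (natDegree_C_mul_X_pow_le _ _).trans (Finset.mem_Icc.mp hk).2
  have hℓeval : ∀ n (j : ℕ), (ℓ n).eval (δ n * j) =
      κ * δ n ^ 2 * (j : ℝ) ^ 2 + ∑ k ∈ Finset.Icc 3 m, g k n * (j : ℝ) ^ k := by
    intro n j
    simp only [ℓ, eval_add, eval_mul, eval_C, eval_pow, eval_X, eval_finsetSum]
    congr 1
    · ring
    · refine Finset.sum_congr rfl fun k _ => ?_
      rw [mul_pow]
      field_simp [pow_ne_zero k (hδ0 n)]
  have hℓlim : CoeffTendsto ℓ (C κ * X ^ 2) := by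
    have h := (CoeffTendsto.const (C κ * X ^ 2)).add (CoeffTendsto.sum (Finset.Icc 3 m)
      (p := fun k n => C (g k n / δ n ^ k) * X ^ k) (q := fun _ => 0) fun k hk => by
        simpa using (CoeffTendsto.C (hg k hk).tendsto_div_nhds_zero).mul
          (CoeffTendsto.const (X ^ k)))
    simpa using h
  -- The exponent is O(δ), so stopping at order m + 1 leaves an error O(δ^(m+2)) = o(δ^(m+1)).
  refine ⟨fun n => ∑ r ∈ Finset.range (m + 2), C (1 / (r.factorial : ℝ)) * ℓ n ^ r, ?_, ?_, ?_⟩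
  · intro n
    refine Nat.lt_succ_of_le (natDegree_sum_le_of_forall_le _ _ fun r hr => ?_)
    refine (natDegree_C_mul_le _ _).trans (natDegree_pow_le.trans ?_)
    exact Nat.mul_le_mul (by have := Finset.mem_range.mp hr; omega) (hℓdeg n)
  · have h := CoeffTendsto.sum (Finset.range (m + 2)) fun r _ =>
      (CoeffTendsto.const (C (1 / (r.factorial : ℝ)))).mul (hℓlim.pow r)
    convert h using 2 with r
    rw [mul_pow, ← C_pow, ← mul_assoc, ← C_mul, ← pow_mul, one_div, div_eq_inv_mul]
  · intro j hj
    set L : ℕ → ℝ := fun n => (ℓ n).eval (δ n * j) with hL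
    have hLO : L =O[atTop] (fun n => δ n ^ 1) := by
      simp only [hL, hℓeval]
      refine IsBigO.add ?_ ?_
      · simp only [mul_assoc, mul_comm (δ _ ^ 2)]
        simp only [← mul_assoc]
        exact (hα.delta_pow_isLittleO (by norm_num : 1 < 2)).isBigO.const_mul_left _
      · refine IsBigO.fun_sum fun k hk => ?_
        have hk3 : 1 < k := by have := (Finset.mem_Icc.mp hk).1; omega
        simp only [mul_comm (g k _)]
        exact ((hg k hk).trans (hα.delta_pow_isLittleO hk3)).isBigO.const_mul_left _
    have hL0 : Tendsto L atTop (𝓝 0) := hLO.trans_tendsto (by simpa using hα.delta_tendsto)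
    set err : ℕ → ℝ := fun n => Real.log (α (n + j) / α n) - A n * j - L n with herr
    have herro : err =o[atTop] (fun n => δ n ^ (m + 1)) := by
      -- The expansion is assumed only for j ≥ 1; at j = 0 every term vanishes.
      rcases Nat.eq_zero_or_pos j with rfl | hj0
      · have : err = fun _ => 0 := by
          funext n
          have hs : ∑ k ∈ Finset.Icc 3 m, g k n * (0 : ℝ) ^ k = 0 :=
            Finset.sum_eq_zero fun k hk => by
              have := (Finset.mem_Icc.mp hk).1
              rw [zero_pow (by omega), mul_zero]
          have hL0 : L n = 0 := by
            have h := hℓeval n 0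
            rw [Nat.cast_zero, hs] at h
            simpa [hL] using h
          simp [herr, hL0]
        rw [this]
        exact isLittleO_zero _ _
      · refine (hexp j (Finset.mem_Icc.mpr ⟨hj0, hj⟩)).congr_left fun n => ?_
        simp only [herr, hL, hℓeval]
        ring
    have herr0 : Tendsto err atTop (𝓝 0) := herro.trans_tendsto (by
      simpa using hα.delta_tendsto.pow (m + 1))
    have hE : ∀ n, α (n + j) / α n * Real.exp (-(A n * j)) = Real.exp (L n + err n) := by
      intro n
      have : L n + err n = Real.log (α (n + j) / α n) + -(A n * j) := by simp only [herr]; ring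
      rw [this, Real.exp_add, Real.exp_log (div_pos (hα.pos _) (hα.pos _))]
    simp only [hE]
    refine ⟨by simpa [Function.comp_def] using
      (Real.continuous_exp.tendsto _).comp (hL0.add herr0), ?_⟩
    have hp : ∀ n, (∑ r ∈ Finset.range (m + 2), C (1 / (r.factorial : ℝ)) * ℓ n ^ r).eval
        (δ n * j) = ∑ r ∈ Finset.range (m + 2), L n ^ r / (r.factorial : ℝ) := by
      intro n
      simp only [eval_finsetSum, eval_mul, eval_C, eval_pow, hL]
      exact Finset.sum_congr rfl fun r _ => by ring
    have h1 : (fun n => Real.exp (L n) - ∑ r ∈ Finset.range (m + 2), L n ^ r / (r.factorial : ℝ))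
        =o[atTop] (fun n => δ n ^ (m + 1)) := by
      have h2 := (Real.exp_sub_sum_range_isBigO_pow (m + 2)).comp_tendsto hL0
      have h3 := hLO.pow (m + 2)
      simp only [pow_one] at h3
      exact (h2.trans h3).trans_isLittleO (hα.delta_pow_isLittleO (by omega))
    have h4 : (fun n => Real.exp (L n) * (Real.exp (err n) - 1))
        =o[atTop] (fun n => δ n ^ (m + 1)) := by
      have h5 := (Real.exp_sub_sum_range_isBigO_pow 1).comp_tendsto herr0
      simp only [Function.comp_def, Finset.sum_range_one, pow_zero, Nat.factorial_zero,
        Nat.cast_one, div_one, pow_one] at h5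
      have h6 : (fun n => Real.exp (L n)) =O[atTop] (fun _ => (1 : ℝ)) :=
        ((Real.continuous_exp.tendsto _).comp hL0).isBigO_one ℝ
      simpa using h6.mul_isLittleO (h5.trans_isLittleO herro)
    refine (h1.add h4).congr_left fun n => ?_
    rw [hp, Real.exp_add]
    ring

theorem tendsto_rescaled_jensen (hα : IsLogPolynomial α m A κ δ) {d : ℕ} (hd : d ≤ m + 1) (w : ℂ) :
    Tendsto (fun n => (∑ j ∈ Finset.range (d + 1), (d.choose j : ℂ) *
        ((α (n + j) / α n * Real.exp (-(A n * j)) : ℝ) : ℂ) * ((δ n : ℂ) * w - 1) ^ j) /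
          (δ n : ℂ) ^ d) atTop (𝓝 ((heatPoly κ d).eval w)) := by
  obtain ⟨p, hpdeg, hplim, hpE⟩ := hα.exists_poly_approx
  have hm := hα.two_le
  have hδ0 : ∀ n, (δ n : ℂ) ≠ 0 := fun n => by exact_mod_cast (hα.delta_pos n).ne'
  have hδ : Tendsto (fun n => (δ n : ℂ)) atTop (𝓝 0) := by
    simpa [Function.comp_def] using (Complex.continuous_ofReal.tendsto 0).comp hα.delta_tendsto
  have hmain := tendsto_rescaled_sum hδ hδ0 w d ((m + 1) * m + 1)
    (a := fun n s => ((p n).coeff s : ℂ)) fun s =>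
      (Complex.continuous_ofReal.tendsto _).comp (hplim s)
  have herr : Tendsto (fun n => ∑ j ∈ Finset.range (d + 1), (d.choose j : ℂ) *
      (((α (n + j) / α n * Real.exp (-(A n * j)) - (p n).eval (δ n * j)) / δ n ^ d : ℝ) : ℂ) *
        ((δ n : ℂ) * w - 1) ^ j) atTop
      (𝓝 (∑ j ∈ Finset.range (d + 1), (d.choose j : ℂ) * ((0 : ℝ) : ℂ) * (0 * w - 1) ^ j)) := by
    refine tendsto_finsetSum _ fun j hj => (tendsto_const_nhds.mul ?_).mul
      (((hδ.mul_const w).sub_const 1).pow j)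
    refine (Complex.continuous_ofReal.tendsto _).comp (IsLittleO.tendsto_div_nhds_zero ?_)
    refine (hpE j (by have := Finset.mem_range.mp hj; omega)).2.trans_isBigO ?_
    rcases hd.lt_or_eq with h | rfl
    · exact (hα.delta_pow_isLittleO h).isBigO
    · exact isBigO_refl _ _
  have hlim : ∑ s ∈ Finset.range ((m + 1) * m + 1),
      (((∑ r ∈ Finset.range (m + 2), C (κ ^ r / (r.factorial : ℝ)) * X ^ (2 * r)).coeff s : ℝ) : ℂ) *
        ((-1) ^ s * (derivative^[s] (X ^ d : ℂ[X])).eval w) = (heatPoly κ d).eval w := by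
    rw [← sum_iterate_derivative_X_pow (κ : ℂ) (R := m + 2) (by omega)]
    simp only [finsetSum_coeff, Complex.ofReal_sum, Finset.sum_mul, eval_finsetSum]
    rw [Finset.sum_comm]
    refine Finset.sum_congr rfl fun r hr => ?_
    rw [Finset.sum_eq_single (2 * r)]
    · rw [coeff_C_mul_X_pow, if_pos rfl]
      simp
    · intro s _ hs
      rw [coeff_C_mul_X_pow, if_neg hs]
      simp
    · intro h
      have := Finset.mem_range.mp hr
      -- Here m ≥ 2 gives 2r ≤ 2(m + 1) ≤ (m + 1)m, so no limiting coefficient is cut off.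
      exact absurd (Finset.mem_range.mpr (by nlinarith)) h
  have h := hmain.add herr
  rw [hlim] at h
  simp only [Complex.ofReal_zero, mul_zero, zero_mul, Finset.sum_const_zero, add_zero] at h
  refine h.congr fun n => ?_
  rw [Finset.sum_div, Finset.sum_div, ← Finset.sum_add_distrib]
  refine Finset.sum_congr rfl fun j _ => ?_
  have he : (((p n).eval (δ n * j) : ℝ) : ℂ) =
      ∑ s ∈ Finset.range ((m + 1) * m + 1), ((p n).coeff s : ℂ) * ((δ n : ℂ) * j) ^ s := by
    rw [eval_eq_sum_range' (hpdeg n)]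
    push_cast
    rfl
  rw [← he]
  push_cast
  ring

/-- The second difference kills the linear term and turns j² into 2; the remaining terms are o(δ²).
-/
theorem log_second_difference_isLittleO (hα : IsLogPolynomial α m A κ δ) :
    (fun n => Real.log (α (n + 2) / α n) - 2 * Real.log (α (n + 1) / α n) - 2 * κ * δ n ^ 2)
      =o[atTop] (fun n => δ n ^ 2) := by
  obtain ⟨g, hg, hexp⟩ := hα.expansion
  have hm := hα.two_le
  have hle : (fun n => δ n ^ (m + 1)) =o[atTop] (fun n => δ n ^ 2) :=
    hα.delta_pow_isLittleO (by omega)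
  have h1 := (hexp 1 (Finset.mem_Icc.mpr ⟨le_rfl, by omega⟩)).trans hle
  have h2 := (hexp 2 (Finset.mem_Icc.mpr ⟨by norm_num, by omega⟩)).trans hle
  have h3 : (fun n => ∑ k ∈ Finset.Icc 3 m, (2 ^ k - 2 : ℝ) * g k n) =o[atTop]
      (fun n => δ n ^ 2) := by
    refine IsLittleO.fun_sum fun k hk => ((hg k hk).trans_isBigO ?_).const_mul_left _
    exact (hα.delta_pow_isLittleO (by have := (Finset.mem_Icc.mp hk).1; omega)).isBigO
  refine ((h2.sub (h1.const_mul_left 2)).add h3).congr_left fun n => ?_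
  have hs : ∑ k ∈ Finset.Icc 3 m, (2 ^ k - 2 : ℝ) * g k n =
      ∑ k ∈ Finset.Icc 3 m, g k n * ((2 : ℕ) : ℝ) ^ k -
        2 * ∑ k ∈ Finset.Icc 3 m, g k n * ((1 : ℕ) : ℝ) ^ k := by
    rw [Finset.mul_sum, ← Finset.sum_sub_distrib]
    refine Finset.sum_congr rfl fun k _ => ?_
    push_cast
    rw [one_pow]
    ring
  rw [hs]
  push_cast
  ring

theorem eventually_sign_log_second_difference (hα : IsLogPolynomial α m A κ δ) :
    ∀ᶠ n in atTop, 0 < κ * (Real.log (α n * α (n + 2)) - Real.log (α (n + 1) ^ 2)) := by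
  filter_upwards [hα.log_second_difference_isLittleO.def one_pos] with n hn
  have h0 := (hα.pos n).ne'
  have h1 := (hα.pos (n + 1)).ne'
  have h2 := (hα.pos (n + 2)).ne'
  have hδ : 0 < δ n ^ 2 := pow_pos (hα.delta_pos n) 2
  rw [Real.log_div h2 h0, Real.log_div h1 h0, one_mul, Real.norm_eq_abs, Real.norm_eq_abs,
    abs_of_pos hδ, abs_le] at hn
  rw [Real.log_mul h0 h2, Real.log_pow]
  push_cast
  rcases hα.kappa with rfl | rfl <;> linarith [hn.1, hn.2]

end IsLogPolynomial

/-! ### Root patterns and their stability -/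

/-- `P` has `d` distinct complex roots, all real if `κ = -1`, and as few real ones as the parity
of `d` permits if `κ = 1`. -/
def HasRootPattern (κ : ℝ) (d : ℕ) (P : ℝ[X]) : Prop :=
  (P.aroots ℂ).card = d ∧ (P.aroots ℂ).Nodup ∧
    (κ = -1 → ∀ z ∈ P.aroots ℂ, z.im = 0) ∧
    (κ = 1 → Even d → ∀ z ∈ P.aroots ℂ, z.im ≠ 0) ∧
    (κ = 1 → Odd d → ∃! z : ℂ, z ∈ P.aroots ℂ ∧ z.im = 0)

theorem aroots_eq_map_of_injOn {P : ℝ[X]} {s : Multiset ℂ} (hs : s.Nodup)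
    (hcard : P.natDegree ≤ s.card) {f : ℂ → ℂ} (hf : Set.InjOn f {z | z ∈ s})
    (hroot : ∀ z ∈ s, f z ∈ P.aroots ℂ) : P.aroots ℂ = s.map f := by
  have hnd : (s.map f).Nodup := (Multiset.nodup_map_iff_inj_on hs).mpr fun x hx y hy h => hf hx hy h
  refine (Multiset.eq_of_le_of_card_le ((Multiset.le_iff_subset hnd).mpr fun z hz => ?_) ?_).symm
  · obtain ⟨y, hy, rfl⟩ := Multiset.mem_map.mp hz
    exact hroot y hy
  · rw [Multiset.card_map, IsAlgClosed.card_aroots_eq_natDegree]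
    exact hcard

theorem HasRootPattern.transfer {κ : ℝ} {d : ℕ} {P P' : ℝ[X]} (h : HasRootPattern κ d P)
    (hdeg : P'.natDegree = d) {f : ℂ → ℂ} (hf : Set.InjOn f {z | z ∈ P.aroots ℂ})
    (hroot : ∀ z ∈ P.aroots ℂ, f z ∈ P'.aroots ℂ)
    (him : ∀ z ∈ P.aroots ℂ, (f z).im = 0 ↔ z.im = 0) : HasRootPattern κ d P' := by
  obtain ⟨hc, hnd, h1, h2, h3⟩ := h
  have hmap := aroots_eq_map_of_injOn hnd (by rw [hdeg, hc]) hf hroot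
  rw [HasRootPattern, hmap]
  refine ⟨by rw [Multiset.card_map, hc],
    (Multiset.nodup_map_iff_inj_on hnd).mpr fun x hx y hy h => hf hx hy h, ?_, ?_, ?_⟩
  · intro hκ z hz
    obtain ⟨y, hy, rfl⟩ := Multiset.mem_map.mp hz
    exact (him y hy).mpr (h1 hκ y hy)
  · intro hκ hd z hz
    obtain ⟨y, hy, rfl⟩ := Multiset.mem_map.mp hz
    exact fun h0 => h2 hκ hd y hy ((him y hy).mp h0)
  · intro hκ hd
    obtain ⟨y, ⟨hy, hy0⟩, huniq⟩ := h3 hκ hd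
    refine ⟨f y, ⟨Multiset.mem_map_of_mem f hy, (him y hy).mpr hy0⟩, ?_⟩
    rintro z ⟨hz, hz0⟩
    obtain ⟨x, hx, rfl⟩ := Multiset.mem_map.mp hz
    rw [huniq x ⟨hx, (him x hx).mp hz0⟩]

/-- If all d zeros were at distance at least ρ from w, the factorization would give |Q(w)| ≥ ρ^d / 2
once the leading coefficient exceeds 1/2 in modulus. -/
theorem eventually_exists_root_near {d : ℕ} {Q : ℕ → ℂ[X]} (hdeg : ∀ n, (Q n).natDegree = d)
    (hlc : Tendsto (fun n => (Q n).leadingCoeff) atTop (𝓝 1)) {w : ℂ}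
    (hw : Tendsto (fun n => (Q n).eval w) atTop (𝓝 0)) {ρ : ℝ} (hρ : 0 < ρ) :
    ∀ᶠ n in atTop, ∃ z ∈ (Q n).roots, ‖z - w‖ < ρ := by
  have h1 : ∀ᶠ n in atTop, 1 / 2 < ‖(Q n).leadingCoeff‖ :=
    hlc.norm.eventually_const_lt (by norm_num)
  have h2 : ∀ᶠ n in atTop, ‖(Q n).eval w‖ < 1 / 2 * ρ ^ d :=
    hw.norm.eventually_lt_const (by rw [norm_zero]; positivity)
  filter_upwards [h1, h2] with n h1 h2
  by_contra! h
  have h3 : ρ ^ d ≤ ((Q n).roots.map fun z => ‖w - z‖).prod := by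
    have h4 := Multiset.prod_map_le_prod_map₀ (s := (Q n).roots) (fun _ => ρ)
      (fun z => ‖w - z‖) (fun _ _ => hρ.le) fun z hz => by
        rw [norm_sub_rev]; exact h z hz
    rwa [Multiset.map_const', Multiset.prod_replicate, IsAlgClosed.card_roots_eq_natDegree,
      hdeg] at h4
  have h5 : ‖(Q n).eval w‖ = ‖(Q n).leadingCoeff‖ * ((Q n).roots.map fun z => ‖w - z‖).prod := by
    rw [(IsAlgClosed.splits (Q n)).eval_eq_prod_roots, norm_mul]
    congr 1
    simpa [Multiset.map_map, Function.comp_def] using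
      map_multiset_prod (normHom : ℂ →*₀ ℝ) ((Q n).roots.map fun z => w - z)
  rw [h5] at h2
  have h6 : 1 / 2 * ρ ^ d ≤ ‖(Q n).leadingCoeff‖ * ((Q n).roots.map fun z => ‖w - z‖).prod :=
    mul_le_mul h1.le h3 (by positivity) (norm_nonneg _)
  linarith

/-- The discs of radius ρ about the points are disjoint, and those about nonreal points miss the
real axis. -/
theorem exists_separation_radius (R : Finset ℂ) :
    ∃ ρ : ℝ, 0 < ρ ∧ (∀ w ∈ R, ∀ w' ∈ R, w ≠ w' → 2 * ρ ≤ ‖w - w'‖) ∧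
      ∀ w ∈ R, w.im ≠ 0 → ρ ≤ |w.im| := by
  have hsmall : ∀ c : ℝ, 0 < c → ∀ᶠ ρ in 𝓝[>] (0 : ℝ), 2 * ρ ≤ c := fun c hc =>
    nhdsWithin_le_nhds ((Continuous.tendsto (by fun_prop : Continuous fun ρ : ℝ => 2 * ρ) 0
      |>.eventually_lt_const (by simpa using hc)).mono fun _ h => h.le)
  have h1 : ∀ᶠ ρ in 𝓝[>] (0 : ℝ), ∀ w ∈ R, ∀ w' ∈ R, w ≠ w' → 2 * ρ ≤ ‖w - w'‖ := by
    rw [Filter.eventually_all_finset]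
    intro w _
    rw [Filter.eventually_all_finset]
    intro w' _
    by_cases h : w = w'
    · simp [h]
    · exact (hsmall _ (norm_pos_iff.mpr (sub_ne_zero.mpr h))).mono fun _ h _ => h
  have h2 : ∀ᶠ ρ in 𝓝[>] (0 : ℝ), ∀ w ∈ R, w.im ≠ 0 → 2 * ρ ≤ |w.im| := by
    rw [Filter.eventually_all_finset]
    intro w _
    by_cases h : w.im = 0
    · simp [h]
    · exact (hsmall _ (abs_pos.mpr h)).mono fun _ h _ => h
  obtain ⟨ρ, ⟨h1, h2⟩, hρ⟩ := ((h1.and h2).and self_mem_nhdsWithin).exists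
  have hρ0 : 0 < ρ := hρ
  exact ⟨ρ, hρ0, h1, fun w hw h => by linarith [h2 w hw h]⟩

theorem conj_mem_aroots {P : ℝ[X]} {z : ℂ} (hz : z ∈ P.aroots ℂ) :
    (starRingEnd ℂ) z ∈ P.aroots ℂ := by
  rw [mem_aroots] at hz ⊢
  exact ⟨hz.1, by rw [aeval_conj, hz.2, map_zero]⟩

/-- Each of the d disjoint discs about the limit zeros contains a zero of `Q n`; by degree these are
all of them, one per disc. -/
theorem eventually_hasRootPattern {κ : ℝ} (hκ : κ = 1 ∨ κ = -1) {d : ℕ} {Q : ℕ → ℝ[X]}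
    (hdeg : ∀ n, (Q n).natDegree = d)
    (hlc : Tendsto (fun n => (Q n).leadingCoeff) atTop (𝓝 1))
    (hQ : ∀ w : ℂ, Tendsto (fun n => aeval w (Q n)) atTop (𝓝 ((heatPoly κ d).eval w))) :
    ∀ᶠ n in atTop, HasRootPattern κ d (Q n) := by
  have hκ0 : (κ : ℂ) ≠ 0 := by rcases hκ with rfl | rfl <;> simp
  set r := (heatPoly κ d).roots with hr
  have hrnd : r.Nodup := nodup_roots_heatPoly hκ0 d
  have hrcard : r.card = d := card_roots_heatPoly κ d
  have hrmem : ∀ w, w ∈ r ↔ (heatPoly κ d).eval w = 0 := fun w => by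
    rw [hr, mem_roots (monic_heatPoly κ d).ne_zero, IsRoot.def]
  obtain ⟨ρ, hρ, hsep, hsepim⟩ := exists_separation_radius r.toFinset
  simp only [Multiset.mem_toFinset] at hsep hsepim
  have hnear : ∀ᶠ n in atTop, ∀ w ∈ r.toFinset, ∃ z ∈ (Q n).aroots ℂ, ‖z - w‖ < ρ := by
    rw [Filter.eventually_all_finset]
    intro w hw
    refine eventually_exists_root_near (Q := fun n => (Q n).map (algebraMap ℝ ℂ)) (d := d)
      (fun n => by rw [natDegree_map, hdeg]) ?_ ?_ hρ
    · simp only [leadingCoeff_map]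
      simpa [Function.comp_def] using (Complex.continuous_ofReal.tendsto _).comp hlc
    · simp only [eval_map_algebraMap]
      have := hQ w
      rwa [(hrmem w).mp (Multiset.mem_toFinset.mp hw)] at this
  filter_upwards [hnear] with n hn
  simp only [Multiset.mem_toFinset] at hn
  have hn' : ∀ w : ℂ, ∃ z : ℂ, w ∈ r → z ∈ (Q n).aroots ℂ ∧ ‖z - w‖ < ρ := fun w => by
    by_cases hw : w ∈ r
    · obtain ⟨z, hz⟩ := hn w hw
      exact ⟨z, fun _ => hz⟩
    · exact ⟨0, fun h => absurd h hw⟩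
  choose f hf using hn'
  have hclose : ∀ w ∈ r, ∀ w' ∈ r, ∀ z, ‖z - w‖ < ρ → ‖z - w'‖ < ρ → w = w' := by
    intro w hw w' hw' z h1 h2
    by_contra hne
    have h3 := hsep w hw w' hw' hne
    have h4 : ‖w - w'‖ ≤ ‖z - w'‖ + ‖z - w‖ := by
      rw [show w - w' = (z - w') - (z - w) by ring]; exact norm_sub_le _ _
    linarith
  have hinj : Set.InjOn f {w | w ∈ r} := fun w hw w' hw' h =>
    hclose w hw w' hw' (f w) (hf w hw).2 (h ▸ (hf w' hw').2)
  have hmap : (Q n).aroots ℂ = r.map f :=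
    aroots_eq_map_of_injOn hrnd (by rw [hdeg, hrcard]) hinj fun w hw => (hf w hw).1
  have him : ∀ w ∈ r, (f w).im = 0 ↔ w.im = 0 := by
    intro w hw
    constructor
    · intro h
      by_contra h0
      have h1 := hsepim w hw h0
      have h2 := Complex.abs_im_le_norm (f w - w)
      rw [Complex.sub_im, h, zero_sub, abs_neg] at h2
      linarith [(hf w hw).2]
    · intro h
      -- The disc about a real w is stable under conjugation, so its only zero equals its own
      -- conjugate.
      have hc := conj_mem_aroots (hf w hw).1
      rw [hmap] at hc
      obtain ⟨w', hw', hc⟩ := Multiset.mem_map.mp hc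
      have h1 : ‖f w' - w‖ < ρ := by
        rw [hc, ← Complex.conj_eq_iff_im.mpr h, ← map_sub, Complex.norm_conj,
          Complex.conj_eq_iff_im.mpr h]
        exact (hf w hw).2
      have h2 := hclose w hw w' hw' (f w') h1 (hf w' hw').2
      rw [← h2] at hc
      exact Complex.conj_eq_iff_im.mp hc.symm
  -- For κ = 1 take u = 1: the limit zeros are purely imaginary, so only 0 can be real.
  have him0 : κ = 1 → ∀ w ∈ r, w.im = 0 → w = 0 := by
    rintro rfl w hw h
    have := re_mul_eq_zero_of_heatPoly_root (κ := ((1 : ℝ) : ℂ)) (u := 1) (by simp) d w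
      ((hrmem w).mp hw)
    rw [one_mul] at this
    exact Complex.ext this h
  have hzero : (0 : ℂ) ∈ r ↔ Odd d := by rw [hrmem, eval_zero_heatPoly_eq_zero_iff hκ0]
  rw [HasRootPattern, hmap]
  refine ⟨by rw [Multiset.card_map, hrcard],
    (Multiset.nodup_map_iff_inj_on hrnd).mpr fun x hx y hy h => hinj hx hy h, ?_, ?_, ?_⟩
  · rintro rfl z hz
    obtain ⟨w, hw, rfl⟩ := Multiset.mem_map.mp hz
    rw [him w hw]
    have := re_mul_eq_zero_of_heatPoly_root (κ := ((-1 : ℝ) : ℂ)) (u := Complex.I) (by simp) d w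
      ((hrmem w).mp hw)
    simpa using this
  · intro h1 hd z hz
    obtain ⟨w, hw, rfl⟩ := Multiset.mem_map.mp hz
    rw [ne_eq, him w hw]
    intro h0
    rw [him0 h1 w hw h0, hzero] at hw
    exact (Nat.not_even_iff_odd.mpr hw) hd
  · intro h1 hd
    have h0 := hzero.mpr hd
    refine ⟨f 0, ⟨Multiset.mem_map_of_mem f h0, (him 0 h0).mpr Complex.zero_im⟩, ?_⟩
    rintro z ⟨hz, hz0⟩
    obtain ⟨w, hw, rfl⟩ := Multiset.mem_map.mp hz
    rw [him0 h1 w hw ((him w hw).mp hz0)]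

/-! ### Jensen polynomials: degrees, reciprocity, affine substitution -/

theorem coeff_jensenJ (α : ℕ → ℝ) (d n k : ℕ) :
    (jensenJ α d n).coeff k = (d.choose k : ℝ) * α (n + k) := by
  simp only [jensenJ, finsetSum_coeff, coeff_C_mul_X_pow, Finset.sum_ite_eq, Finset.mem_range]
  split_ifs with h
  · rfl
  · rw [Nat.choose_eq_zero_of_lt (by omega)]; simp

theorem natDegree_jensenJ {α : ℕ → ℝ} (hα : ∀ n, 0 < α n) (d n : ℕ) :
    (jensenJ α d n).natDegree = d := by
  refine natDegree_eq_of_le_of_coeff_ne_zero ?_ ?_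
  · exact natDegree_sum_le_of_forall_le _ _ fun j hj =>
      (natDegree_C_mul_X_pow_le _ _).trans (by have := Finset.mem_range.mp hj; omega)
  · rw [coeff_jensenJ, Nat.choose_self, Nat.cast_one, one_mul]
    exact (hα _).ne'

theorem coeff_jensenK_degree (α : ℕ → ℝ) (d n : ℕ) : (jensenK α d n).coeff d = α n := by
  simp only [jensenK, finsetSum_coeff, coeff_C_mul_X_pow]
  rw [Finset.sum_eq_single 0]
  · simp
  · intro j hj hj0
    have := Finset.mem_range.mp hj
    rw [if_neg (by omega)]
  · simp

theorem natDegree_jensenK {α : ℕ → ℝ} (hα : ∀ n, 0 < α n) (d n : ℕ) :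
    (jensenK α d n).natDegree = d := by
  refine natDegree_eq_of_le_of_coeff_ne_zero ?_ ?_
  · exact natDegree_sum_le_of_forall_le _ _ fun j _ =>
      (natDegree_C_mul_X_pow_le _ _).trans (Nat.sub_le d j)
  · rw [coeff_jensenK_degree]
    exact (hα _).ne'

theorem aeval_jensenJ (α : ℕ → ℝ) (d n : ℕ) (z : ℂ) : aeval z (jensenJ α d n) =
    ∑ j ∈ Finset.range (d + 1), (d.choose j : ℂ) * (α (n + j) : ℂ) * z ^ j := by
  simp [jensenJ]

theorem aeval_jensenK_inv_mul_pow (α : ℕ → ℝ) (d n : ℕ) {z : ℂ} (hz : z ≠ 0) :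
    aeval z⁻¹ (jensenK α d n) * z ^ d = aeval z (jensenJ α d n) := by
  rw [aeval_jensenJ, jensenK, map_sum, Finset.sum_mul]
  refine Finset.sum_congr rfl fun j hj => ?_
  have hj' : d = (d - j) + j := by have := Finset.mem_range.mp hj; omega
  have h1 : z⁻¹ ^ (d - j) * z ^ d = z ^ j := by
    conv_lhs => rw [hj', Nat.add_sub_cancel, pow_add, ← mul_assoc, ← mul_pow,
      inv_mul_cancel₀ hz, one_pow, one_mul]
  simp only [map_mul, aeval_C, map_pow, aeval_X, Complex.coe_algebraMap]
  rw [mul_assoc, h1]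
  push_cast
  rfl

/-- Inversion carries the zeros of J, nonzero because α(n) ≠ 0, to those of K and preserves
realness. -/
theorem HasRootPattern.jensenK_of_jensenJ {α : ℕ → ℝ} (hα : ∀ n, 0 < α n) {κ : ℝ} {d n : ℕ}
    (h : HasRootPattern κ d (jensenJ α d n)) : HasRootPattern κ d (jensenK α d n) := by
  have hne : jensenK α d n ≠ 0 := fun h0 => (hα n).ne' (by
    rw [← coeff_jensenK_degree α d n, h0, coeff_zero])
  have hz0 : ∀ z ∈ (jensenJ α d n).aroots ℂ, z ≠ 0 := by
    rintro z hz rfl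
    have h1 := (mem_aroots.mp hz).2
    rw [← coeff_zero_eq_aeval_zero', coeff_jensenJ] at h1
    simp [(hα n).ne'] at h1
  refine h.transfer (natDegree_jensenK hα d n) (f := fun z => z⁻¹) inv_injective.injOn
    (fun z hz => ?_) fun z hz => ?_
  · rw [mem_aroots]
    refine ⟨hne, ?_⟩
    have h1 := aeval_jensenK_inv_mul_pow α d n (hz0 z hz)
    rw [(mem_aroots.mp hz).2] at h1
    exact (mul_eq_zero.mp h1).resolve_right (pow_ne_zero d (hz0 z hz))
  · rw [Complex.inv_im, div_eq_zero_iff, neg_eq_zero, Complex.normSq_eq_zero]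
    exact or_iff_left (hz0 z hz)

theorem HasRootPattern.of_comp_linear {κ c a b : ℝ} {d : ℕ} {P : ℝ[X]} (hc : c ≠ 0) (ha : a ≠ 0)
    (hdeg : P.natDegree = d) (hP : P ≠ 0)
    (h : HasRootPattern κ d (C c * P.comp (C a * X - C b))) : HasRootPattern κ d P := by
  have ha' : (a : ℂ) ≠ 0 := by exact_mod_cast ha
  refine h.transfer hdeg (f := fun z => a * z - b) ?_ (fun z hz => ?_) fun z _ => ?_
  · exact fun x _ y _ hxy => mul_left_cancel₀ ha' (sub_left_injective hxy)
  · rw [mem_aroots]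
    refine ⟨hP, ?_⟩
    have h1 := (mem_aroots.mp hz).2
    rw [map_mul, aeval_C, aeval_comp] at h1
    have h2 := (mul_eq_zero.mp h1).resolve_left (by simpa using hc)
    simpa using h2
  · simp [ha]

/-! ### Conclusion -/

namespace IsLogPolynomial

variable {α : ℕ → ℝ} {m : ℕ} {A : ℕ → ℝ} {κ : ℝ} {δ : ℕ → ℝ}

theorem eventually_hasRootPattern_jensenJ (hα : IsLogPolynomial α m A κ δ) {d : ℕ}
    (hd : d ≤ m + 1) : ∀ᶠ n in atTop, HasRootPattern κ d (jensenJ α d n) := by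
  have hα0 : ∀ n, α n ≠ 0 := fun n => (hα.pos n).ne'
  have hδ0 : ∀ n, δ n ≠ 0 := fun n => (hα.delta_pos n).ne'
  have hJ := natDegree_jensenJ hα.pos d
  have hJ0 : ∀ n, jensenJ α d n ≠ 0 := fun n h0 => hα0 n (by
    simpa [h0] using (coeff_jensenJ α d n 0).symm)
  -- Substituting exp(-A)(δX - 1) and multiplying by `c n` gives the rescaled sum with limit
  -- `heatPoly κ d`; its leading coefficient is E_n(d), which tends to 1.
  let c : ℕ → ℝ := fun n => (α n * δ n ^ d)⁻¹
  let b : ℕ → ℝ := fun n => Real.exp (-A n)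
  let a : ℕ → ℝ := fun n => δ n * b n
  have hc : ∀ n, c n ≠ 0 := fun n => inv_ne_zero (mul_ne_zero (hα0 n) (pow_ne_zero _ (hδ0 n)))
  have ha : ∀ n, a n ≠ 0 := fun n => mul_ne_zero (hδ0 n) (Real.exp_ne_zero _)
  have hb : ∀ n (j : ℕ), Real.exp (-(A n * j)) = b n ^ j := fun n j => by
    rw [← Real.exp_nat_mul]; congr 1; ring
  have hlin : ∀ n, (C (a n) * X - C (b n)).natDegree = 1 := fun n => by
    rw [natDegree_sub_C, natDegree_C_mul_X _ (ha n)]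
  have hlinlc : ∀ n, (C (a n) * X - C (b n)).leadingCoeff = a n := fun n => by
    rw [leadingCoeff, hlin]; simp
  have hQ : ∀ᶠ n in atTop, HasRootPattern κ d
      (C (c n) * (jensenJ α d n).comp (C (a n) * X - C (b n))) := by
    refine eventually_hasRootPattern hα.kappa (fun n => ?_) ?_ fun w => ?_
    · rw [natDegree_C_mul (hc n), natDegree_comp, hJ, hlin, mul_one]
    · obtain ⟨_, _, _, hp⟩ := hα.exists_poly_approx
      refine (hp d hd).1.congr fun n => ?_
      rw [leadingCoeff_mul, leadingCoeff_C, leadingCoeff_comp (by rw [hlin]; exact one_ne_zero),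
        hlinlc, hJ, leadingCoeff, hJ, coeff_jensenJ, Nat.choose_self, hb]
      have := hα0 n
      have := hδ0 n
      simp only [c, a]
      push_cast
      field_simp
      ring
    · refine (hα.tendsto_rescaled_jensen hd w).congr fun n => ?_
      have h1 : (α n : ℂ) ≠ 0 := by exact_mod_cast hα0 n
      have h2 : (δ n : ℂ) ≠ 0 := by exact_mod_cast hδ0 n
      rw [map_mul, aeval_C, aeval_comp, aeval_jensenJ, Finset.mul_sum, Finset.sum_div]
      refine Finset.sum_congr rfl fun j _ => ?_
      have h3 : aeval w (C (a n) * X - C (b n)) = (b n : ℂ) * ((δ n : ℂ) * w - 1) := by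
        simp only [a, map_sub, map_mul, aeval_C, aeval_X, Complex.coe_algebraMap]
        ring
      rw [h3, hb, mul_pow]
      simp only [c, Complex.coe_algebraMap]
      push_cast
      field_simp
  filter_upwards [hQ] with n hn
  exact hn.of_comp_linear (hc n) (ha n) (hJ n) (hJ0 n)

theorem asympStrictLogConcave (hα : IsLogPolynomial α m A κ δ) (hκ : κ = -1) :
    AsympStrictLogConcave α := by
  filter_upwards [hα.eventually_sign_log_second_difference] with n hn
  refine (Real.log_lt_log_iff (mul_pos (hα.pos _) (hα.pos _)) (pow_pos (hα.pos _) 2)).mp ?_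
  rw [hκ] at hn
  linarith

theorem asympStrictLogConvex (hα : IsLogPolynomial α m A κ δ) (hκ : κ = 1) :
    AsympStrictLogConvex α := by
  filter_upwards [hα.eventually_sign_log_second_difference] with n hn
  refine (Real.log_lt_log_iff (pow_pos (hα.pos _) 2) (mul_pos (hα.pos _) (hα.pos _))).mp ?_
  rw [hκ] at hn
  linarith

end IsLogPolynomial

theorem theorem1p7 (α : ℕ → ℝ) (m : ℕ) (A : ℕ → ℝ) (κ : ℝ) (δ : ℕ → ℝ)
    (hα : IsLogPolynomial α m A κ δ) :
    ((κ = -1 → AsympStrictLogConcave α) ∧ (κ = 1 → AsympStrictLogConvex α)) ∧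
    ∀ d : ℕ, 1 ≤ d → d ≤ m + 1 → ∀ᶠ n in atTop,
      ∀ P : ℝ[X], P = jensenJ α d n ∨ P = jensenK α d n →
        (P.aroots ℂ).card = d ∧ (P.aroots ℂ).Nodup ∧
        (κ = -1 → ∀ z ∈ P.aroots ℂ, z.im = 0) ∧
        (κ = 1 → Even d → ∀ z ∈ P.aroots ℂ, z.im ≠ 0) ∧
        (κ = 1 → Odd d → ∃! z : ℂ, z ∈ P.aroots ℂ ∧ z.im = 0) := by
  refine ⟨⟨hα.asympStrictLogConcave, hα.asympStrictLogConvex⟩, fun d _ hd => ?_⟩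
  filter_upwards [hα.eventually_hasRootPattern_jensenJ hd] with n hn P hP
  rcases hP with rfl | rfl
  · exact hn
  · exact hn.jensenK_of_jensenJ hα.pos
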